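/- **Setting.** Let $\ell_0=\log x$, $\ell_1=\log\log x,\dots$ be the iterated logarithms. For a finitely supported real vector $\alpha=(\alpha_0,\alpha_1,\dots)$ put $\ell^\alpha=\prod_i\ell_i^{\alpha_i}$, and let $\theta=x\frac{d}{dx}$, so that $\theta\ell^\alpha=\sum_i\alpha_i\,\ell^\alpha/(\ell_0\cdots\ell_i)$. The Roman factorial of a real number $a$ is $\lfloor a\rceil!=\Gamma(a+1)$ if $a$ is not a negative integer, and $\lfloor -n\rceil!=(-1)^{n-1}/(n-1)!$ for $n=1,2,\dots$. The harmonic logarithms are $$\lambda_a^\alpha(x)=\lfloor a\rceil!\,x^a\sum_{k\ge0}s(-a,k)\,\theta^k\ell^\alpha ,\qquad \frac{\Gamma(y+1)}{\Gamma(y+a+1)}=\sum_{k\ge0}s(-a,k)\,y^k ,$$ so that $\frac{d}{dx}\lambda_a^\alpha=\frac{\lfloor a\rceil!}{\lfloor a-1\rceil!}\lambda_{a-1}^\alpha$. Let $\mathcal I^\alpha$ be the space of series $\sum_{a\in\mathbb R}c_a\lambda_a^\alpha(x)$, $c_a\in\mathbb C$, whose support contains no infinite strictly increasing sequence. For $p\in\mathcal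 I^\alpha$ let $\langle p\rangle_\alpha$ be the coefficient of $\lambda_0^\alpha$ in $p$. An Artinian operator is a series $f(D)=\sum_{b\in\mathbb R}f_bD^b$, $f_b\in\mathbb C$, with well-ordered support. It acts on $\mathcal I^\alpha$, $\alpha\ne(0)$, by $D^b\lambda_a^\alpha=\frac{\lfloor a\rceil!}{\lfloor a-b\rceil!}\lambda_{a-b}^\alpha$. If $f=cD^d(1+\varepsilon)$ with $c\neq0$ and $\varepsilon$ of positive degree, put $f^{b;0}=c^bD^{bd}\sum_{k\ge0}\binom bk\varepsilon^k$ for real $b$, with the principal value of $c^b$, and define $h(f;0)=\sum_a h_af^{a;0}$ for $h=\sum_a h_aD^a$. A *standard delta operator* is an Artinian operator of degree one whose leading coefficient is a positive real number. Its *compositional inverse* $f^{(-1;0)}(D)$ is the standard delta operator $g$ with $f(g;0)=D=g(f;0)$. A family $p_a^\alpha(x)$ (over all $a\in\mathbb R$ and all $\alpha$) is *regular* if for all $\alpha\ne(0)$ and all $\beta$ the series $p_a^\beta$ is obtained from $p_a^\alpha$ by replacing each $\lambda_b^\alpha$ by $\lambda_b^\beta$. It is a *graded sequence* if it is regular and,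 for $\alpha\ne(0)$, $p_a^\alpha\in\mathcal I^\alpha$ has degree $a$ (the largest $b$ for which $\lambda_b^\alpha$ occurs in it is $a$). * The *standard associated graded sequence* of $f(D)$ is the graded sequence such that for all $\alpha\neq(0)$ and all real $a,b$: $\langle p_0^\alpha\rangle_\alpha=1$, $\langle p_a^\alpha\rangle_\alpha=0$ if $a\ne0$, and $f(D)^{b;0}p_a^\alpha=\frac{\lfloor a\rceil!}{\lfloor a-b\rceil!}\,p_{a-b}^\alpha$. * The *standard conjugate graded sequence* of $f(D)$ is the regular family such that for all $\alpha\ne(0)$ and all $a$ $$p_a^\alpha(x)=\sum_{b}\frac{\langle f(D)^{b;0}\lambda_a^\alpha(x)\rangle_\alpha}{\lfloor b\rceil!}\,\lambda_b^\alpha(x).$$ **Theorem.** Let $f(D)$ be a standard delta operator. Then $f(D)$ has exactly one compositional inverse $f^{(-1;0)}(D)$ among the standard delta operators, and $f(D)$ has exactly one standard associated graded sequence and exactly one standard conjugate graded sequence. Moreover, the standard associated graded sequence of $f(D)$ is the standard conjugate graded sequence of $f^{(-1;0)}(D)$, and the standard conjugate graded sequence of $f(D)$ is the standard associated graded sequence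 of $f^{(-1;0)}(D)$. -/

import Mathlib

noncomputable section

namespace LogAlg

/-- Formal series in the monomials `x ^ a * ℓ₀ ^ β₀ * ℓ₁ ^ β₁ * ⋯`, where `ℓ₀ = log x`,
`ℓ₁ = log log x`, … are the iterated logarithms, `a` is a real number and `β` is a finitely
supported vector of real numbers: `F a β` is the coefficient of that monomial. -/
abbrev LogSeries : Type := ℝ → (ℕ →₀ ℝ) → ℂ

/-- The exponent vector of `ℓ₀ * ℓ₁ * ⋯ * ℓᵢ`. -/
def logProd (i : ℕ) : ℕ →₀ ℝ := ∑ j ∈ Finset.range (i + 1), Finsupp.single j 1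

/-- The derivation `θ = x * d/dx` on finite combinations of the monomials
`ℓ^α = ℓ₀ ^ α₀ * ℓ₁ ^ α₁ * ⋯`, that is, `θ ℓ^α = ∑ i, αᵢ * ℓ^α / (ℓ₀ * ⋯ * ℓᵢ)`. -/
def theta : ((ℕ →₀ ℝ) →₀ ℂ) →ₗ[ℂ] ((ℕ →₀ ℝ) →₀ ℂ) :=
  Finsupp.linearCombination ℂ fun α : ℕ →₀ ℝ =>
    ∑ i ∈ α.support, Finsupp.single (α - logProd i) (α i : ℂ)

/-- The formal derivative `d/dx`:
`d/dx (x ^ a * ℓ^β) = x ^ (a - 1) * (a * ℓ^β + ∑ i, βᵢ * ℓ^β / (ℓ₀ * ⋯ * ℓᵢ))`. -/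
def formalDeriv (F : LogSeries) : LogSeries := fun a β =>
  ((a : ℂ) + 1) * F (a + 1) β + ∑ᶠ i : ℕ, ((β i : ℂ) + 1) * F (a + 1) (β + logProd i)

open Classical in
/-- The Roman factorial `⌊a⌉!` of a real number: `Γ(a + 1)` unless `a` is a negative integer, and
`(-1) ^ (n - 1) / (n - 1)!` for `a = -n` with `n = 1, 2, …`. -/
def romanFactorial (a : ℝ) : ℝ :=
  if ∃ m : ℕ, a = -((m : ℝ) + 1) then (-1) ^ (⌊-a⌋₊ - 1) / ((⌊-a⌋₊ - 1).factorial : ℝ)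
  else Real.Gamma (a + 1)

/-- The Roman number `⌊a⌉`. -/
def romanNumber (a : ℝ) : ℝ := if a = 0 then 1 else a

/-- The generalized Stirling number `s(-a, k)`: the coefficient of `y ^ k` in the expansion of the
lower factorial `(y)₋ₐ = Γ(y + 1) / Γ(y + a + 1)` at `y = 0`. -/
def stirling (a : ℝ) (k : ℕ) : ℂ :=
  iteratedDeriv k (fun y : ℂ => Complex.Gamma (y + 1) / Complex.Gamma (y + a + 1)) 0 / k.factorial

/-- The harmonic logarithm
`λ_a^α(x) = ⌊a⌉! * x ^ a * ∑ k, s(-a, k) * θ^k ℓ^α`. For `α = 0` it is `x ^ a`, or `0` if `a` is a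
negative integer; for `a = 0` it is `ℓ^α`. -/
def harmonicLog (a : ℝ) (α : ℕ →₀ ℝ) : LogSeries := fun b β =>
  if b = a then
    (romanFactorial a : ℂ) * ∑ᶠ k : ℕ, stirling a k * ((theta ^ k) (Finsupp.single α 1)) β
  else 0

theorem logProd_apply (i j : ℕ) : logProd i j = if j ≤ i then 1 else 0 := by
  simp [logProd, Finsupp.finsetSum_apply, Finsupp.single_apply]

theorem logProd_injective : Function.Injective logProd := by
  intro i j h
  have h1 := DFunLike.congr_fun h i
  have h2 := DFunLike.congr_fun h j
  simp only [logProd_apply] at h1 h2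
  grind

theorem theta_apply (P : (ℕ →₀ ℝ) →₀ ℂ) (β : ℕ →₀ ℝ) :
    (Function.support fun i : ℕ => ((β i : ℂ) + 1) * P (β + logProd i)).Finite ∧
    theta P β = ∑ᶠ i : ℕ, ((β i : ℂ) + 1) * P (β + logProd i) := by
  have hfin : ∀ P : (ℕ →₀ ℝ) →₀ ℂ,
      (Function.support fun i : ℕ => ((β i : ℂ) + 1) * P (β + logProd i)).Finite := by
    intro P
    refine ((P.support.finite_toSet.preimage (f := fun i : ℕ => β + logProd i) ?_)).subset ?_
    · intro i _ j _ h
      exact logProd_injective (add_left_cancel h)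
    · intro i hi
      simp only [Function.mem_support] at hi
      simpa using right_ne_zero_of_mul hi
  refine ⟨hfin P, ?_⟩
  induction P using Finsupp.induction_linear with
  | zero => simp
  | add P Q hP hQ =>
    rw [map_add, Finsupp.add_apply, hP, hQ, ← finsum_add_distrib (hfin P) (hfin Q)]
    refine finsum_congr fun i => ?_
    rw [Finsupp.add_apply]; ring
  | single γ c =>
    simp only [theta, Finsupp.linearCombination_single, Finsupp.smul_apply,
      Finsupp.finsetSum_apply, smul_eq_mul, Finsupp.single_apply]
    by_cases h : ∃ i, γ = β + logProd i
    · obtain ⟨i, rfl⟩ := h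
      rw [finsum_eq_single _ i (by
        intro j hj
        rw [if_neg, mul_zero]
        intro h
        exact hj (logProd_injective (add_left_cancel h)).symm)]
      rw [Finset.sum_eq_single i]
      · simp [logProd_apply]; ring
      · intro j _ hj
        rw [if_neg]
        intro h
        apply hj
        apply logProd_injective
        have := sub_eq_iff_eq_add.mp h
        exact (add_left_cancel this).symm
      · intro hi
        rw [Finsupp.notMem_support_iff] at hi
        simp [hi]
    · push Not at h
      rw [finsum_eq_zero_of_forall_eq_zero (fun i => by rw [if_neg (h i), mul_zero])]
      rw [Finset.sum_eq_zero, mul_zero]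
      intro i _
      rw [if_neg]
      intro h'
      exact h i (sub_eq_iff_eq_add.mp h')

theorem theta_pow_apply_eq_zero (α β : ℕ →₀ ℝ) (k : ℕ) (h : β 0 + k ≠ α 0) :
    (theta ^ k) (Finsupp.single α 1) β = 0 := by
  induction k generalizing β with
  | zero =>
    rw [pow_zero, Module.End.one_apply, Finsupp.single_apply, if_neg]
    rintro rfl
    simp at h
  | succ k ih =>
    rw [pow_succ', Module.End.mul_apply, (theta_apply _ β).2]
    refine finsum_eq_zero_of_forall_eq_zero fun i => ?_
    rw [ih, mul_zero]
    simp only [Finsupp.add_apply, logProd_apply]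
    push_cast at h
    simpa [add_assoc, add_comm] using h

theorem contDiffAt_gammaQuot (a : ℝ) (n : ℕ) :
    ContDiffAt ℂ n (fun y : ℂ => Complex.Gamma (y + 1) / Complex.Gamma (y + a + 1)) 0 := by
  have h1 : ContDiff ℂ n (fun y : ℂ => (Complex.Gamma (y + a + 1))⁻¹) := by
    have : Differentiable ℂ (fun y : ℂ => (Complex.Gamma (y + a + 1))⁻¹) :=
      Complex.differentiable_one_div_Gamma.comp (by fun_prop : Differentiable ℂ fun y : ℂ => y + a + 1)
    exact this.contDiff
  have h2 : ContDiffAt ℂ n (fun y : ℂ => Complex.Gamma (y + 1)) 0 := by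
    have : DifferentiableOn ℂ (fun y : ℂ => Complex.Gamma (y + 1)) (Metric.ball 0 1) := by
      intro y hy
      refine DifferentiableAt.differentiableWithinAt ?_
      refine DifferentiableAt.comp y (g := Complex.Gamma) (Complex.differentiableAt_Gamma _ ?_) (by fun_prop)
      intro m hm
      have h := congrArg Complex.re hm
      have h' : |y.re| < 1 := (Complex.abs_re_le_norm y).trans_lt (by simpa using hy)
      rw [abs_lt] at h'
      have : (0:ℝ) ≤ m := m.cast_nonneg
      simp at h
      linarith
    exact (this.contDiffOn Metric.isOpen_ball).contDiffAt (Metric.ball_mem_nhds _ one_pos)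
  simp only [div_eq_mul_inv]
  exact h2.mul h1.contDiffAt

theorem gammaQuot_sub_one (a : ℝ) (y : ℂ) :
    Complex.Gamma (y + 1) / Complex.Gamma (y + (a - 1 : ℝ) + 1) =
      (y + a) * (Complex.Gamma (y + 1) / Complex.Gamma (y + a + 1)) := by
  have := Complex.one_div_Gamma_eq_self_mul_one_div_Gamma_add_one (y + a)
  push_cast
  rw [show y + (a - 1 : ℂ) + 1 = y + a by ring, div_eq_mul_inv, this]
  ring

theorem stirling_sub_one_zero (a : ℝ) : stirling (a - 1) 0 = a * stirling a 0 := by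
  simp only [stirling, iteratedDeriv_zero, gammaQuot_sub_one]
  simp

theorem stirling_sub_one_succ (a : ℝ) (k : ℕ) :
    stirling (a - 1) (k + 1) = a * stirling a (k + 1) + stirling a k := by
  simp only [stirling, gammaQuot_sub_one]
  rw [iteratedDeriv_fun_mul (by fun_prop) (contDiffAt_gammaQuot a (k + 1))]
  rw [Finset.sum_range_succ', Finset.sum_range_succ']
  rw [Finset.sum_eq_zero]
  · have hk : ((k.factorial : ℕ) : ℂ) ≠ 0 := by exact_mod_cast k.factorial_ne_zero
    have hk1 : (k : ℂ) + 1 ≠ 0 := by exact_mod_cast k.succ_ne_zero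
    simp [Nat.factorial_succ]
    field_simp
    ring
  · intro i _
    have : iteratedDeriv (i + 1 + 1) (fun y : ℂ => y + a) 0 = 0 := by
      rw [iteratedDeriv_succ', iteratedDeriv_succ']
      simp
    rw [this]; ring

theorem romanFactorial_eq (a : ℝ) :
    romanFactorial a = romanNumber a * romanFactorial (a - 1) := by
  by_cases h : ∃ m : ℕ, a = -((m : ℝ) + 1)
  · have h' : ∃ m : ℕ, a - 1 = -((m : ℝ) + 1) := by
      obtain ⟨m, rfl⟩ := h
      exact ⟨m + 1, by push_cast; ring⟩
    rw [romanFactorial, romanFactorial, if_pos h, if_pos h', romanNumber]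
    obtain ⟨m, rfl⟩ := h
    have e1 : ⌊-(-((m : ℝ) + 1))⌋₊ = m + 1 := by
      rw [neg_neg]; exact_mod_cast Nat.floor_natCast (R := ℝ) (m + 1)
    have e2 : ⌊-(-((m : ℝ) + 1) - 1)⌋₊ = m + 2 := by
      rw [show -(-((m : ℝ) + 1) - 1) = ((m + 2 : ℕ) : ℝ) by push_cast; ring, Nat.floor_natCast]
    have hm : (0 : ℝ) < m + 1 := by positivity
    have hm' : ((m.factorial : ℕ) : ℝ) ≠ 0 := by exact_mod_cast m.factorial_ne_zero
    rw [e1, e2, if_neg (by linarith)]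
    simp only [Nat.add_sub_cancel, show m + 2 - 1 = m + 1 from rfl, Nat.factorial_succ]
    push_cast
    field_simp
    ring
  · by_cases h0 : a = 0
    · subst h0
      have h' : ∃ m : ℕ, (0 : ℝ) - 1 = -((m : ℝ) + 1) := ⟨0, by simp⟩
      rw [romanFactorial, romanFactorial, if_neg h, if_pos h', romanNumber]
      simp
    · have h' : ¬ ∃ m : ℕ, a - 1 = -((m : ℝ) + 1) := by
        rintro ⟨m, hm⟩
        rcases m with _ | m
        · apply h0; simp at hm; linarith
        · exact h ⟨m, by push_cast at hm; linarith⟩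
      rw [romanFactorial, romanFactorial, if_neg h, if_neg h', romanNumber, if_neg h0,
        Real.Gamma_add_one h0]
      simp

/-- The derivative of a harmonic logarithm: `d/dx λ_a^α(x) = ⌊a⌉ λ_{a - 1}^α(x)`. -/
theorem formalDeriv_harmonicLog (a : ℝ) (α : ℕ →₀ ℝ) :
    formalDeriv (harmonicLog a α) = (romanNumber a : ℂ) • harmonicLog (a - 1) α := by
  funext b β
  by_cases hb : b = a - 1
  swap
  · have : b + 1 ≠ a := fun h => hb (by linarith)
    simp [formalDeriv, harmonicLog, hb, this]
  subst hb
  have hc : ((a - 1 : ℝ) : ℂ) + 1 = a := by push_cast; ring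
  simp only [formalDeriv, harmonicLog, sub_add_cancel, if_true, Pi.smul_apply, smul_eq_mul]
  rw [← mul_assoc (romanNumber a : ℂ), ← Complex.ofReal_mul, ← romanFactorial_eq, hc]
  have key : ∀ (c : ℕ → ℂ) (γ : ℕ →₀ ℝ) (k : ℕ), γ 0 + k = α 0 →
      ∑ᶠ j : ℕ, c j * ((theta ^ j) (Finsupp.single α 1)) γ
        = c k * ((theta ^ k) (Finsupp.single α 1)) γ := by
    intro c γ k hk
    refine finsum_eq_single _ k fun j hj => ?_
    rw [theta_pow_apply_eq_zero, mul_zero]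
    intro h
    apply hj
    have : (j : ℝ) = k := by linarith
    exact_mod_cast this
  have key0 : ∀ (c : ℕ → ℂ) (γ : ℕ →₀ ℝ), (∀ k : ℕ, γ 0 + k ≠ α 0) →
      ∑ᶠ j : ℕ, c j * ((theta ^ j) (Finsupp.single α 1)) γ = 0 := by
    intro c γ h
    refine finsum_eq_zero_of_forall_eq_zero fun j => ?_
    rw [theta_pow_apply_eq_zero _ _ _ (h j), mul_zero]
  have hP : ∀ i, (β + logProd i) 0 = β 0 + 1 := by intro i; simp [logProd_apply]
  by_cases h : ∃ k : ℕ, β 0 + k = α 0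
  · obtain ⟨k, hk⟩ := h
    rw [key _ β k hk, key _ β k hk]
    rcases k with _ | k
    · rw [finsum_eq_zero_of_forall_eq_zero, stirling_sub_one_zero]
      · ring
      · intro i
        rw [key0, mul_zero, mul_zero]
        intro j hj
        rw [hP] at hj
        have : (0 : ℝ) ≤ j := j.cast_nonneg
        simp at hk
        linarith
    · have : ∀ i, ∑ᶠ j : ℕ, stirling a j * ((theta ^ j) (Finsupp.single α 1)) (β + logProd i)
          = stirling a k * ((theta ^ k) (Finsupp.single α 1)) (β + logProd i) := by
        intro i
        refine key _ _ k ?_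
        rw [hP]; push_cast at hk; linarith
      simp only [this]
      have h2 := (theta_apply ((theta ^ k) (Finsupp.single α 1)) β).2
      rw [← Module.End.mul_apply, ← pow_succ'] at h2
      rw [stirling_sub_one_succ, h2]
      have h3 : ∀ i, ((β i : ℂ) + 1) * ((romanFactorial a : ℂ) *
          (stirling a k * ((theta ^ k) (Finsupp.single α 1)) (β + logProd i)))
          = (romanFactorial a * stirling a k) *
            (((β i : ℂ) + 1) * ((theta ^ k) (Finsupp.single α 1)) (β + logProd i)) := by
        intro i; ring
      simp only [h3]
      rw [← mul_finsum]
      rw [← h2]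
      ring
  · push Not at h
    rw [key0 _ _ h, key0 _ _ h, finsum_eq_zero_of_forall_eq_zero]
    · simp
    · intro i
      rw [key0, mul_zero, mul_zero]
      intro j hj
      apply h (j + 1)
      rw [hP] at hj; push_cast; linarith

/-- The series `∑ b, c b * λ_b^α(x)`. As `λ_b^α(x)` has only monomials with `x ^ b`, no two terms
contribute to the same monomial. -/
def logSum (α : ℕ →₀ ℝ) (c : ℝ → ℂ) : LogSeries := fun b β => c b * harmonicLog b α b β

/-- The space `𝓘^α` of the series `∑ b, c b * λ_b^α(x)` with Noetherian support (no infinite strictly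
increasing sequence of exponents). -/
def logSpace (α : ℕ →₀ ℝ) : Set LogSeries :=
  {F | ∃ c : ℝ → ℂ, (Function.support c).WellFoundedOn (· > ·) ∧ F = logSum α c}

open Classical in
/-- The coefficient `[λ_b^α(x)] F` for `F` in `𝓘^α`, read off at some monomial that occurs in
`λ_b^α(x)`; it is set to `0` if `λ_b^α(x) = 0`. -/
def logCoeff (α : ℕ →₀ ℝ) (F : LogSeries) (b : ℝ) : ℂ :=
  if h : ∃ β, harmonicLog b α b β ≠ 0 then F b h.choose / harmonicLog b α b h.choose else 0

/-- The augmentation `⟨F⟩_α`, the coefficient of `λ_0^α(x)`. -/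
def augmentation (α : ℕ →₀ ℝ) (F : LogSeries) : ℂ := logCoeff α F 0

/-- The skip operator `E_{β,α}`, which maps `λ_b^α(x)` to `λ_b^β(x)`. -/
def skip (β α : ℕ →₀ ℝ) (F : LogSeries) : LogSeries := logSum β (logCoeff α F)

/-- Artinian operators: series `f(D) = ∑ b, f_b * D ^ b` with real exponents and well-ordered
support. -/
abbrev ArtinianOp : Type := HahnSeries ℝ ℂ

/-- The operator `D`. -/
def opD : ArtinianOp := HahnSeries.single 1 1

/-- The action of `f(D)` on `𝓘^α`, where
`D ^ b λ_a^α(x) = (⌊a⌉! / ⌊a - b⌉!) * λ_{a - b}^α(x)`. -/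
def opApply (f : ArtinianOp) (α : ℕ →₀ ℝ) (F : LogSeries) : LogSeries :=
  logSum α fun e =>
    ∑ᶠ b : ℝ, f.coeff b * ((romanFactorial (e + b) / romanFactorial e : ℝ) : ℂ) *
      logCoeff α F (e + b)

/-- The power `f^{b;0}`: if `f = c * D ^ d * (1 + ε)` with `c ≠ 0` and `ε` of positive degree, then
`f^{b;0} = c ^ b * D ^ (b * d) * ∑ k, (b choose k) * ε ^ k`, with the principal value of `c ^ b`. -/
def opPow (f : ArtinianOp) (b : ℝ) : ArtinianOp :=
  HahnSeries.single (b * f.order) (f.leadingCoeff ^ (b : ℂ)) *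
    (HahnSeries.SummableFamily.binomialFamily
      (HahnSeries.single (-f.order) f.leadingCoeff⁻¹ * f) b).hsum

/-- A standard delta operator: an Artinian operator of degree one whose leading coefficient is a
positive real number. -/
def IsStandardDelta (f : ArtinianOp) : Prop :=
  f.order = 1 ∧ ∃ c : ℝ, 0 < c ∧ f.leadingCoeff = (c : ℂ)

/-- `h` is the composition `f(g;0) = ∑ a, f_a * g^{a;0}`. -/
def IsComp (f g h : ArtinianOp) : Prop :=
  ∀ e : ℝ, h.coeff e = ∑ᶠ a : ℝ, f.coeff a * (opPow g a).coeff e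

/-- `g` is the compositional inverse `f^{(-1;0)}` of `f`. -/
def IsCompInverse (f g : ArtinianOp) : Prop := IsComp f g opD ∧ IsComp g f opD

/-- A family `p_a^α(x)` is regular if all of it is obtained by the skip operators from its members
in any one of the spaces `𝓘^α` with `α ≠ 0`. -/
def IsRegular (p : ℝ → (ℕ →₀ ℝ) → LogSeries) : Prop :=
  ∀ a : ℝ, ∀ α β : ℕ →₀ ℝ, α ≠ 0 → p a β = skip β α (p a α)

/-- A graded sequence: a regular family in which `p_a^α(x)` is, for `α ≠ 0`, a member of `𝓘^α` of
degree `a`. -/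
def IsGradedSequence (p : ℝ → (ℕ →₀ ℝ) → LogSeries) : Prop :=
  IsRegular p ∧ ∀ a : ℝ, ∀ α : ℕ →₀ ℝ, α ≠ 0 →
    p a α ∈ logSpace α ∧ logCoeff α (p a α) a ≠ 0 ∧ ∀ b : ℝ, a < b → logCoeff α (p a α) b = 0

/-- `p` is the standard (that is, `0`th) associated graded sequence of `f(D)`. -/
def IsStandardAssociated (f : ArtinianOp) (p : ℝ → (ℕ →₀ ℝ) → LogSeries) : Prop :=
  IsGradedSequence p ∧ ∀ α : ℕ →₀ ℝ, α ≠ 0 →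
    augmentation α (p 0 α) = 1 ∧
    (∀ a : ℝ, a ≠ 0 → augmentation α (p a α) = 0) ∧
    ∀ a b : ℝ, opApply (opPow f b) α (p a α) =
      ((romanFactorial a / romanFactorial (a - b) : ℝ) : ℂ) • p (a - b) α

/-- `p` is the standard (that is, `0`th) conjugate graded sequence of `f(D)`:
`p_a^α(x) = ∑ b, (⟨f(D)^{b;0} λ_a^α(x)⟩_α / ⌊b⌉!) * λ_b^α(x)`. -/
def IsStandardConjugate (f : ArtinianOp) (p : ℝ → (ℕ →₀ ℝ) → LogSeries) : Prop :=
  IsRegular p ∧ ∀ a : ℝ, ∀ α : ℕ →₀ ℝ, α ≠ 0 →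
    p a α = logSum α fun b =>
      augmentation α (opApply (opPow f b) α (harmonicLog a α)) / (romanFactorial b : ℂ)

end LogAlg

end

/-!
The powers of a standard delta operator `f = c * D * (1 + ε)` are encoded in the matrix
`M_f(a, e) = (opPow f a).coeff e`, which is upper triangular with the nonzero diagonal `c ^ a`, and in
which `M_f(a, e) ≠ 0` only if `e - a` lies in the well-ordered monoid generated by the exponents of
`ε` (`defectMonoid f`). Hence every sum below is finite, and `h ↦ h(f;0)` is an injective map of
Hahn series (`IsStandardDelta.comp`), multiplicative because `f^{a+b;0} = f^{a;0} f^{b;0}`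
(`comp_mul`).

*Compositional inverse.* Triangularity allows one to solve `g(f;0) = D` by well-founded recursion
(`exists_comp_eq_opD`). Multiplicativity gives `g^{n;0}(f;0) = D ^ n` for natural `n`. The relevant
coefficients of `g^{b;0}(f;0)` are polynomials in `b`, since binomial coefficients are, so
`g^{b;0}(f;0) = D ^ b` for every real `b` (`comp_opPow`). It follows that `(h(g;0))(f;0) = h` for all
`h` (`comp_comp`); for `h = f` this and the injectivity of composition with `f` yield `f(g;0) = D`.

*Graded sequences.* For `α ≠ 0` the harmonic logarithms `λ_b^α` are nonzero
(`exists_harmonicLog_ne_zero`), so series in them have unique coefficients. The conjugate sequence of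
`f` is `p_a = ∑ b, M_f(b, a) * (⌊a⌉! / ⌊b⌉!) * λ_b` (`isStandardConjugate_iff`). That it is associated
to `g` comes down to `∑ x, M_g(b, x) * M_f(e + x, a) = M_f(e, a - b)`, which is a coefficient of
`(D ^ e * g^{b;0})(f;0) = f^{e;0} * D ^ b` (`finsum_coeff_opPow_mul`). Conversely, the coefficients of
an associated sequence solve a triangular system with a unique solution of Noetherian support
(`eq_of_isStandardAssociated`).
-/

noncomputable section

namespace LogAlg

open HahnSeries HahnSeries.SummableFamily
open scoped Polynomial

/-! ### Powers of standard delta operators -/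

/-- The unit part `1 + ε` of `f = c * D ^ d * (1 + ε)`. -/
def unitPart (f : ArtinianOp) : ArtinianOp := single (-f.order) f.leadingCoeff⁻¹ * f

/-- The additive monoid generated by the exponents of `ε`, where `f = c * D ^ d * (1 + ε)`. All the
exponents of `f^{a;0}` lie in `a * d + defectMonoid f`. -/
def defectMonoid (f : ArtinianOp) : AddSubmonoid ℝ :=
  AddSubmonoid.closure (unitPart f - 1).support

/-- The leading coefficient of a standard delta operator, as a real number. -/
def leadReal (f : ArtinianOp) : ℝ := f.leadingCoeff.re

namespace IsStandardDelta

variable {f g : ArtinianOp}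

theorem ne_zero (hf : IsStandardDelta f) : f ≠ 0 := by
  rintro rfl
  simpa using hf.1

theorem leadReal_pos (hf : IsStandardDelta f) : 0 < leadReal f := by
  obtain ⟨_, c, hc, h⟩ := hf
  simpa [leadReal, h] using hc

theorem leadingCoeff_eq (hf : IsStandardDelta f) : f.leadingCoeff = (leadReal f : ℂ) := by
  obtain ⟨_, c, hc, h⟩ := hf
  simp [leadReal, h]

theorem leadingCoeff_cpow (hf : IsStandardDelta f) (a : ℝ) :
    f.leadingCoeff ^ (a : ℂ) = ((leadReal f ^ a : ℝ) : ℂ) := by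
  rw [hf.leadingCoeff_eq, Complex.ofReal_cpow hf.leadReal_pos.le]

theorem orderTop_unitPart_sub_one_pos (hf : IsStandardDelta f) :
    0 < (unitPart f - 1).orderTop := by
  have hl : f.leadingCoeff ≠ 0 := HahnSeries.leadingCoeff_ne_zero.mpr hf.ne_zero
  have hs : (single (-f.order) f.leadingCoeff⁻¹ : ArtinianOp) ≠ 0 := by
    simpa using hf.ne_zero
  have h0 : unitPart f ≠ 0 := mul_ne_zero hs hf.ne_zero
  rw [orderTop_self_sub_one_pos_iff]
  constructor
  · rw [← order_eq_orderTop_of_ne_zero h0, unitPart, order_mul hs hf.ne_zero,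
      order_single (inv_ne_zero hl)]
    simp
  · rw [unitPart, HahnSeries.leadingCoeff_mul, leadingCoeff_of_single, inv_mul_cancel₀ hl]

theorem opPow_eq (hf : IsStandardDelta f) (a : ℝ) :
    opPow f a = single a ((leadReal f ^ a : ℝ) : ℂ) *
      PowerSeries.heval (unitPart f - 1) (PowerSeries.binomialSeries ℂ a) := by
  rw [opPow, hf.leadingCoeff_cpow, hf.1, mul_one, ← hf.1]
  rfl

theorem opPow_zero (hf : IsStandardDelta f) : opPow f 0 = 1 := by
  rw [hf.opPow_eq, PowerSeries.binomialSeries_zero, map_one]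
  simp

theorem opPow_add (hf : IsStandardDelta f) (a b : ℝ) :
    opPow f (a + b) = opPow f a * opPow f b := by
  rw [hf.opPow_eq, hf.opPow_eq, hf.opPow_eq, PowerSeries.binomialSeries_add, map_mul,
    mul_mul_mul_comm, single_mul_single, Real.rpow_add hf.leadReal_pos, Complex.ofReal_mul]

theorem opPow_one (hf : IsStandardDelta f) : opPow f 1 = f := by
  have hl : f.leadingCoeff ≠ 0 := HahnSeries.leadingCoeff_ne_zero.mpr hf.ne_zero
  have h := PowerSeries.binomialSeries_nat (R := ℝ) (A := ℂ) 1
  rw [Nat.cast_one, pow_one] at h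
  rw [hf.opPow_eq, h, map_add, map_one, PowerSeries.heval_X _ hf.orderTop_unitPart_sub_one_pos,
    add_sub_cancel, unitPart, ← mul_assoc, single_mul_single, hf.1, Real.rpow_one,
    ← hf.leadingCoeff_eq, mul_inv_cancel₀ hl]
  simp

theorem nonneg_of_mem_defectMonoid (hf : IsStandardDelta f) {x : ℝ} (hx : x ∈ defectMonoid f) :
    0 ≤ x := by
  refine AddSubmonoid.closure_induction (motive := fun x _ => 0 ≤ x) ?_ le_rfl
    (fun x y _ _ => add_nonneg) hx
  intro y hy
  have := hf.orderTop_unitPart_sub_one_pos.trans_le (orderTop_le_of_coeff_ne_zero hy)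
  exact le_of_lt (by exact_mod_cast this)

theorem isPWO_defectMonoid (hf : IsStandardDelta f) : (defectMonoid f : Set ℝ).IsPWO :=
  (unitPart f - 1).isPWO_support.addSubmonoid_closure fun _ hx =>
    hf.nonneg_of_mem_defectMonoid (AddSubmonoid.subset_closure hx)

/-- Relative to `c ^ a`, each coefficient of `f^{a;0}` at a fixed distance from the leading term is a
polynomial in `a`, because the binomial coefficients are. -/
theorem exists_polynomial_coeff_opPow (hf : IsStandardDelta f) (x : ℝ) :
    ∃ q : ℂ[X], ∀ a : ℝ,
      (opPow f a).coeff (a + x) = ((leadReal f ^ a : ℝ) : ℂ) * q.eval (a : ℂ) := by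
  have hpos := hf.orderTop_unitPart_sub_one_pos
  have hfin := pow_finite_co_support hpos x
  refine ⟨∑ n ∈ hfin.toFinset, Polynomial.C ((n.factorial : ℂ)⁻¹ * ((unitPart f - 1) ^ n).coeff x) *
    descPochhammer ℂ n, fun a => ?_⟩
  rw [hf.opPow_eq, add_comm, coeff_single_mul_add, PowerSeries.coeff_heval,
    finsum_eq_sum_of_support_subset (s := hfin.toFinset), Polynomial.eval_finsetSum]
  · congr 1
    refine Finset.sum_congr rfl fun n _ => ?_
    have hch : ((Ring.choose a n : ℝ) : ℂ) =
        (n.factorial : ℂ)⁻¹ * (descPochhammer ℂ n).eval (a : ℂ) := by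
      rw [Ring.choose_eq_smul, ← descPochhammer_map (Int.castRingHom ℂ), Polynomial.eval_map,
        ← Polynomial.aeval_eq_smeval]
      have h := Polynomial.hom_eval₂ (descPochhammer ℤ n) (Int.castRingHom ℝ) Complex.ofRealHom a
      rw [RingHom.ext_int (Complex.ofRealHom.comp (Int.castRingHom ℝ)) (Int.castRingHom ℂ)] at h
      simp only [Complex.ofRealHom_eq_coe] at h
      simp [Polynomial.aeval_def, h]
    simp [hpos, coeff_apply, hch]
    ring
  · intro n hn
    simp only [Set.Finite.coe_toFinset, Set.mem_ofPred_eq]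
    intro h
    apply hn
    simp [coeff_apply, hpos, h]

theorem sub_mem_of_coeff_opPow_ne_zero (hf : IsStandardDelta f) {a e : ℝ}
    (h : (opPow f a).coeff e ≠ 0) : e - a ∈ defectMonoid f := by
  rw [hf.opPow_eq, coeff_single_mul, PowerSeries.coeff_heval] at h
  obtain ⟨n, hn⟩ : ∃ n, (powerSeriesFamily (unitPart f - 1)
      (PowerSeries.binomialSeries ℂ a)).coeff (e - a) n ≠ 0 := by
    by_contra! hc
    exact h (by rw [finsum_eq_zero_of_forall_eq_zero hc, mul_zero])
  refine support_pow_subset_closure (unitPart f - 1) n ?_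
  intro h0
  apply hn
  simp [coeff_apply, hf.orderTop_unitPart_sub_one_pos, h0]

theorem coeff_opPow_self (hf : IsStandardDelta f) (a : ℝ) :
    (opPow f a).coeff a = ((leadReal f ^ a : ℝ) : ℂ) := by
  rw [hf.opPow_eq, coeff_single_mul, sub_self, PowerSeries.coeff_heval_zero]
  simp

theorem coeff_opPow_self_ne_zero (hf : IsStandardDelta f) (a : ℝ) :
    (opPow f a).coeff a ≠ 0 := by
  rw [hf.coeff_opPow_self]
  exact_mod_cast (Real.rpow_pos_of_pos hf.leadReal_pos a).ne'

theorem coeff_opPow_of_lt (hf : IsStandardDelta f) {a e : ℝ} (h : e < a) :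
    (opPow f a).coeff e = 0 := by
  by_contra h0
  linarith [hf.nonneg_of_mem_defectMonoid (hf.sub_mem_of_coeff_opPow_ne_zero h0)]

end IsStandardDelta

/-! ### Composition and the compositional inverse -/

theorem finite_setOf_mem_and_sub_mem {S T : Set ℝ} (hS : S.IsPWO) (hT : T.IsPWO) (e : ℝ) :
    {a | a ∈ S ∧ e - a ∈ T}.Finite := by
  refine ((Set.AddAntidiagonal.finite_of_isPWO hS hT e).image Prod.fst).subset ?_
  rintro a ⟨ha, hb⟩
  exact ⟨(a, e - a), ⟨ha, hb, by simp⟩, rfl⟩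

/-- The coefficient of a product as a sum over all real exponents. -/
theorem coeff_mul_eq_finsum (h k : ArtinianOp) (a : ℝ) :
    (h * k).coeff a = ∑ᶠ i : ℝ, h.coeff i * k.coeff (a - i) := by
  rw [HahnSeries.coeff_mul]
  have hf := finite_setOf_mem_and_sub_mem h.isPWO_support k.isPWO_support a
  rw [finsum_eq_sum_of_support_subset (s := hf.toFinset)]
  · refine Finset.sum_bij (fun p _ => p.1) ?_ ?_ ?_ ?_
    · rintro ⟨i, j⟩ hp
      obtain ⟨hi, hj, rfl⟩ := Finset.mem_antidiagonal.mp hp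
      simpa using And.intro hi hj
    · rintro ⟨i, j⟩ hp ⟨i', j'⟩ hp' (rfl : i = i')
      have h1 := (Finset.mem_antidiagonal.mp hp).2.2
      have h2 := (Finset.mem_antidiagonal.mp hp').2.2
      simp only at h1 h2
      rw [show j = j' by linarith]
    · intro i hi
      obtain ⟨hi, hj⟩ := hf.mem_toFinset.mp hi
      exact ⟨(i, a - i), Finset.mem_antidiagonal.mpr ⟨hi, hj, by simp⟩, rfl⟩
    · rintro ⟨i, j⟩ hp
      obtain ⟨hi, hj, rfl⟩ := Finset.mem_antidiagonal.mp hp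
      simp
  · intro i hi
    simp only [Set.Finite.coe_toFinset, Set.mem_ofPred_eq]
    exact ⟨left_ne_zero_of_mul hi, right_ne_zero_of_mul hi⟩

namespace IsStandardDelta

variable {f g h k : ArtinianOp}

/-- The summable family `a ↦ h_a * f^{a;0}`. -/
def compFamily (hf : IsStandardDelta f) (h : ArtinianOp) : SummableFamily ℝ ℂ ℝ where
  toFun a := h.coeff a • opPow f a
  isPWO_iUnion_support' := by
    refine (h.isPWO_support.add hf.isPWO_defectMonoid).mono (Set.iUnion_subset fun a e he => ?_)
    rw [HahnSeries.mem_support, HahnSeries.coeff_smul, smul_eq_mul] at he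
    exact ⟨a, left_ne_zero_of_mul he, e - a,
      hf.sub_mem_of_coeff_opPow_ne_zero (right_ne_zero_of_mul he), by simp⟩
  finite_co_support' e := by
    refine (finite_setOf_mem_and_sub_mem h.isPWO_support hf.isPWO_defectMonoid e).subset ?_
    intro a ha
    have ha : h.coeff a * (opPow f a).coeff e ≠ 0 := by simpa using ha
    exact ⟨left_ne_zero_of_mul ha, hf.sub_mem_of_coeff_opPow_ne_zero (right_ne_zero_of_mul ha)⟩

/-- The composition `h(f;0)` as an Artinian operator. -/
def comp (hf : IsStandardDelta f) (h : ArtinianOp) : ArtinianOp := (hf.compFamily h).hsum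

theorem coeff_comp (hf : IsStandardDelta f) (h : ArtinianOp) (e : ℝ) :
    (hf.comp h).coeff e = ∑ᶠ a : ℝ, h.coeff a * (opPow f a).coeff e := by
  rw [comp, coeff_hsum]
  rfl

theorem isComp_iff (hf : IsStandardDelta f) : IsComp h f k ↔ hf.comp h = k := by
  rw [HahnSeries.ext_iff, funext_iff]
  simp only [coeff_comp, IsComp, eq_comm]

theorem comp_single (hf : IsStandardDelta f) (a : ℝ) : hf.comp (single a 1) = opPow f a := by
  ext e
  rw [coeff_comp, finsum_eq_single _ a fun b hb => by rw [coeff_single_of_ne hb, zero_mul]]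
  simp

theorem comp_opD (hf : IsStandardDelta f) : hf.comp opD = f := by
  rw [opD, comp_single, hf.opPow_one]

/-- Composition with `f` on the right is multiplicative, by the law `f^{a+b;0} = f^{a;0} f^{b;0}`. -/
theorem comp_mul (hf : IsStandardDelta f) (h k : ArtinianOp) :
    hf.comp (h * k) = hf.comp h * hf.comp k := by
  ext e
  rw [coeff_comp, comp, comp, ← hsum_mul, coeff_hsum]
  have key : ∀ p : ℝ × ℝ, (((hf.compFamily h).mul (hf.compFamily k)) p).coeff e =
      h.coeff p.1 * k.coeff p.2 * (opPow f (p.1 + p.2)).coeff e := by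
    intro p
    have : ((hf.compFamily h).mul (hf.compFamily k)) p =
        (h.coeff p.1 • opPow f p.1) * (k.coeff p.2 • opPow f p.2) := rfl
    rw [this, hf.opPow_add, ← C_mul_eq_smul, ← C_mul_eq_smul, mul_mul_mul_comm, ← map_mul,
      C_mul_eq_smul, HahnSeries.coeff_smul, smul_eq_mul]
  -- Pairs `(i, j)` of exponents are indexed by their sum `i + j` and by `i`.
  let E : ℝ × ℝ ≃ ℝ × ℝ :=
    { toFun := fun p => (p.2, p.1 - p.2)
      invFun := fun p => (p.1 + p.2, p.1)
      left_inv := fun p => by simp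
      right_inv := fun p => by simp }
  have hfin := ((hf.compFamily h).mul (hf.compFamily k)).finite_co_support e
  rw [← finsum_comp_equiv E, finsum_curry]
  · refine finsum_congr fun a => ?_
    rw [coeff_mul_eq_finsum, finsum_mul']
    · refine finsum_congr fun i => ?_
      rw [key]
      simp [E]
    · refine (finite_setOf_mem_and_sub_mem h.isPWO_support k.isPWO_support a).subset fun i hi => ?_
      exact ⟨left_ne_zero_of_mul hi, right_ne_zero_of_mul hi⟩
  · exact hfin.preimage E.injective.injOn

/-- If `h` has no terms of degree below `d`, then neither has `h(f;0)`, and the coefficient of degree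
`d` is multiplied by a nonzero number. -/
theorem coeff_comp_eq_of_forall_lt (hf : IsStandardDelta f) {d : ℝ}
    (hh : ∀ e < d, h.coeff e = 0) :
    (hf.comp h).coeff d = h.coeff d * (opPow f d).coeff d := by
  rw [coeff_comp]
  refine finsum_eq_single _ d fun a ha => ?_
  rcases ha.lt_or_gt with h1 | h1
  · rw [hh a h1, zero_mul]
  · rw [hf.coeff_opPow_of_lt h1, mul_zero]

theorem comp_sub (hf : IsStandardDelta f) (h k : ArtinianOp) :
    hf.comp (h - k) = hf.comp h - hf.comp k := by
  rw [comp, comp, comp, ← hsum_sub]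
  congr 1
  ext a : 1
  exact sub_smul _ _ _

theorem comp_injective (hf : IsStandardDelta f) : Function.Injective hf.comp := by
  intro h k hhk
  by_contra hne
  have h0 : h - k ≠ 0 := sub_ne_zero.mpr hne
  have h1 : (hf.comp (h - k)).coeff (h - k).order =
      (h - k).coeff (h - k).order * (opPow f (h - k).order).coeff (h - k).order :=
    hf.coeff_comp_eq_of_forall_lt fun e he => coeff_eq_zero_of_lt_order he
  rw [hf.comp_sub, sub_eq_zero.mpr hhk, HahnSeries.coeff_zero] at h1
  exact mul_ne_zero (coeff_order_eq_zero.not.mpr h0) (hf.coeff_opPow_self_ne_zero _) h1.symm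

/-- If `g(f;0) = D`, then `g^{b;0}(f;0) = D ^ b` for all real `b`. For natural `b` this is
multiplicativity of composition; the coefficients of both sides, at a fixed distance from the leading
term, are polynomials in `b`, so the identity extends to real exponents. -/
theorem comp_opPow (hf : IsStandardDelta f) (hg : IsStandardDelta g) (h : hf.comp g = opD) (b : ℝ) :
    hf.comp (opPow g b) = single b 1 := by
  have hlead : leadReal g * leadReal f = 1 := by
    have h1 := hf.coeff_comp_eq_of_forall_lt (h := g) (d := 1)
      fun e he => coeff_eq_zero_of_lt_order (by rwa [hg.1])
    rw [h, opD, coeff_single_same, hf.coeff_opPow_self, Real.rpow_one,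
      ← hg.opPow_one, hg.coeff_opPow_self, Real.rpow_one] at h1
    exact_mod_cast h1.symm
  have hnat : ∀ n : ℕ, hf.comp (opPow g n) = single (n : ℝ) 1 := by
    intro n
    induction n with
    | zero =>
      have : (1 : ArtinianOp) = single 0 1 := rfl
      rw [Nat.cast_zero, hg.opPow_zero, this, comp_single, hf.opPow_zero, this]
    | succ n ih =>
      rw [Nat.cast_succ, hg.opPow_add, comp_mul, ih, hg.opPow_one, h, opD, single_mul_single, one_mul]
  choose qf hqf using hf.exists_polynomial_coeff_opPow
  choose qg hqg using hg.exists_polynomial_coeff_opPow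
  -- The factors `c_g ^ a` and `c_f ^ (a + y)` of the terms combine to `c_f ^ y`, as `c_g * c_f = 1`.
  have hpoly : ∀ x : ℝ, ∃ q : ℂ[X], ∀ a : ℝ,
      (hf.comp (opPow g a)).coeff (a + x) = q.eval (a : ℂ) := by
    intro x
    have hfin := finite_setOf_mem_and_sub_mem hg.isPWO_defectMonoid hf.isPWO_defectMonoid x
    refine ⟨∑ y ∈ hfin.toFinset, Polynomial.C ((leadReal f ^ y : ℝ) : ℂ) * qg y *
      (qf (x - y)).comp (Polynomial.X + Polynomial.C (y : ℂ)), fun a => ?_⟩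
    rw [coeff_comp, ← finsum_comp_equiv (Equiv.addLeft a),
      finsum_eq_sum_of_support_subset (s := hfin.toFinset), Polynomial.eval_finsetSum]
    · refine Finset.sum_congr rfl fun y _ => ?_
      have e1 : a + x = (a + y) + (x - y) := by ring
      have e2 : leadReal g ^ a * leadReal f ^ (a + y) = leadReal f ^ y := by
        rw [Real.rpow_add hf.leadReal_pos, ← mul_assoc,
          ← Real.mul_rpow hg.leadReal_pos.le hf.leadReal_pos.le, hlead, Real.one_rpow, one_mul]
      rw [Equiv.coe_addLeft, e1, hqf, hqg, ← e2]
      simp only [Polynomial.eval_mul, Polynomial.eval_comp, Polynomial.eval_C, Polynomial.eval_add,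
        Polynomial.eval_X]
      push_cast
      ring
    · intro y hy
      simp only [Equiv.coe_addLeft] at hy
      have h1 := hg.sub_mem_of_coeff_opPow_ne_zero (left_ne_zero_of_mul hy)
      have h2 := hf.sub_mem_of_coeff_opPow_ne_zero (right_ne_zero_of_mul hy)
      rw [add_sub_cancel_left] at h1
      rw [add_sub_add_left_eq_sub] at h2
      simpa using And.intro h1 h2
  ext e
  obtain ⟨q, hq⟩ := hpoly (e - b)
  have hqC : q = Polynomial.C ((single (0 : ℝ) (1 : ℂ)).coeff (e - b)) := by
    refine Polynomial.eq_of_infinite_eval_eq _ _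
      ((Set.infinite_range_of_injective (Nat.cast_injective (R := ℂ))).mono ?_)
    rintro _ ⟨n, rfl⟩
    have := hq n
    rw [hnat, Complex.ofReal_natCast] at this
    simp only [Set.mem_ofPred_eq]
    rw [← this, Polynomial.eval_C]
    simp [coeff_single]
  have := hq b
  rw [add_sub_cancel, hqC, Polynomial.eval_C] at this
  rw [this]
  simp [coeff_single, sub_eq_zero]

/-- Composition is associative in the case `(h(g;0))(f;0) = h(D;0) = h`, for `g(f;0) = D`. -/
theorem comp_comp (hf : IsStandardDelta f) (hg : IsStandardDelta g) (h : hf.comp g = opD)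
    (k : ArtinianOp) : hf.comp (hg.comp k) = k := by
  ext x
  have hfin : (Function.support fun p : ℝ × ℝ =>
      k.coeff p.1 * (opPow g p.1).coeff p.2 * (opPow f p.2).coeff x).Finite := by
    have h1 := finite_setOf_mem_and_sub_mem
      (k.isPWO_support.add hg.isPWO_defectMonoid) hf.isPWO_defectMonoid x
    refine Set.Finite.subset (h1.biUnion (t := fun e => (fun a => (a, e)) ''
      {a | a ∈ k.support ∧ e - a ∈ (defectMonoid g : Set ℝ)}) fun e _ =>
      (finite_setOf_mem_and_sub_mem k.isPWO_support hg.isPWO_defectMonoid e).image _) ?_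
    rintro ⟨a, e⟩ hp
    have h2 := hf.sub_mem_of_coeff_opPow_ne_zero (right_ne_zero_of_mul hp)
    have h3 := hg.sub_mem_of_coeff_opPow_ne_zero (right_ne_zero_of_mul (left_ne_zero_of_mul hp))
    have h4 := left_ne_zero_of_mul (left_ne_zero_of_mul hp)
    refine Set.mem_biUnion (x := e) ⟨⟨a, h4, e - a, h3, by simp⟩, h2⟩ ⟨a, ⟨h4, h3⟩, rfl⟩
  have e1 : (hf.comp (hg.comp k)).coeff x =
      ∑ᶠ p : ℝ × ℝ, k.coeff p.1 * (opPow g p.1).coeff p.2 * (opPow f p.2).coeff x := by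
    rw [← finsum_comp_equiv (Equiv.prodComm ℝ ℝ), finsum_curry, coeff_comp]
    · refine finsum_congr fun e => ?_
      rw [coeff_comp, finsum_mul']
      · rfl
      · exact ((hg.compFamily k).finite_co_support e)
    · exact hfin.preimage (Equiv.prodComm ℝ ℝ).injective.injOn
  have e2 : k.coeff x =
      ∑ᶠ p : ℝ × ℝ, k.coeff p.1 * (opPow g p.1).coeff p.2 * (opPow f p.2).coeff x := by
    rw [finsum_curry _ hfin]
    have : ∀ a, ∑ᶠ e, k.coeff a * (opPow g a).coeff e * (opPow f e).coeff x =
        k.coeff a * (single a (1 : ℂ)).coeff x := by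
      intro a
      rw [← hf.comp_opPow hg h a, coeff_comp, mul_finsum]
      exact finsum_congr fun e => mul_assoc _ _ _
    simp only [this]
    rw [finsum_eq_single _ x fun a ha => by rw [coeff_single_of_ne ha.symm, mul_zero]]
    simp
  rw [e1, e2]

theorem comp_eq_opD_symm (hf : IsStandardDelta f) (hg : IsStandardDelta g)
    (h : hf.comp g = opD) : hg.comp f = opD :=
  hf.comp_injective (by rw [hf.comp_comp hg h, hf.comp_opD])

/-- The equation `g(f;0) = D` is triangular in the coefficients of `g`, and is solved by recursion
along the well-ordered set `1 + defectMonoid f`. -/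
theorem exists_comp_eq_opD (hf : IsStandardDelta f) :
    ∃ g, IsStandardDelta g ∧ hf.comp g = opD := by
  classical
  let S : Set ℝ := {x | x - 1 ∈ defectMonoid f}
  have hS : S.IsPWO := ((Set.isPWO_singleton (1 : ℝ)).add hf.isPWO_defectMonoid).mono
    fun x hx => ⟨1, rfl, x - 1, hx, by simp⟩
  have hwf : WellFounded fun a b : S => (a : ℝ) < b := hS.isWF
  have hne := hf.coeff_opPow_self_ne_zero
  -- The coefficient of `D ^ e` in `g(f;0) = D`, solved for `g_e`.
  obtain ⟨u, hu⟩ : ∃ u : S → ℂ, ∀ e : S, u e = (opD.coeff e - ∑ᶠ a : ℝ,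
      if h : ∃ _ : a ∈ S, a < e then u ⟨a, h.1⟩ * (opPow f a).coeff e else 0) /
        (opPow f e).coeff e :=
    ⟨hwf.fix fun e r => (opD.coeff e - ∑ᶠ a : ℝ,
      if h : ∃ _ : a ∈ S, a < e then r ⟨a, h.1⟩ h.2 * (opPow f a).coeff e else 0) /
        (opPow f e).coeff e, fun e => hwf.fix_eq _ e⟩
  let v : ℝ → ℂ := fun x => if h : x ∈ S then u ⟨x, h⟩ else 0
  have hv0 : ∀ x, x ∉ S → v x = 0 := fun x hx => dif_neg hx
  have hv : ∀ e ∈ S, v e * (opPow f e).coeff e = opD.coeff e -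
      ∑ᶠ a : ℝ, if a < e then v a * (opPow f a).coeff e else 0 := by
    intro e he
    have h1 : v e = u ⟨e, he⟩ := dif_pos he
    rw [h1, hu, div_mul_cancel₀ _ (hne e)]
    congr 1
    refine finsum_congr fun a => ?_
    by_cases ha : a ∈ S
    · by_cases hae : a < e
      · simp only [ha, hae, exists_prop, and_self, dite_true, if_true, v]
      · simp [hae]
    · simp [ha, hv0 a ha]
  let g : ArtinianOp :=
    { coeff := v
      isPWO_support' := hS.mono fun x hx => by_contra fun h => hx (hv0 x h) }
  have hcomp : hf.comp g = opD := by
    ext e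
    by_cases he : e ∈ S
    · have h1 : (hf.comp g).coeff e =
          ∑ᶠ a : ℝ, ((if a = e then v e * (opPow f e).coeff e else 0) +
            if a < e then v a * (opPow f a).coeff e else 0) := by
        rw [coeff_comp]
        refine finsum_congr fun a => ?_
        rcases lt_trichotomy a e with h | rfl | h
        · simp [h, h.ne, g]
        · simp [g]
        · simp [h.ne', h.not_gt, hf.coeff_opPow_of_lt h]
      rw [h1, finsum_add_distrib, finsum_eq_single _ e fun a ha => if_neg ha, if_pos rfl, hv e he,
        sub_add_cancel]
      · exact (Set.finite_singleton e).subset fun a ha => by_contra fun h => ha (if_neg h)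
      · refine ((hf.compFamily g).finite_co_support e).subset fun a ha => ?_
        have h2 : v a * (opPow f a).coeff e ≠ 0 := fun h => ha (by simp [h])
        exact h2
    · rw [coeff_comp, opD, coeff_single_of_ne]
      · refine finsum_eq_zero_of_forall_eq_zero fun a => ?_
        by_contra h
        have h1 : a ∈ S := by_contra fun h' => h (by rw [show g.coeff a = v a from rfl, hv0 a h',
          zero_mul])
        have h2 := add_mem (hf.sub_mem_of_coeff_opPow_ne_zero (right_ne_zero_of_mul h)) h1
        exact he (by simpa [S] using h2)
      · rintro rfl
        exact he (by simp [S])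
  have hlt : ∀ e < 1, g.coeff e = 0 := fun e he => hv0 e fun h => by
    linarith [hf.nonneg_of_mem_defectMonoid h]
  have h1 := hf.coeff_comp_eq_of_forall_lt hlt
  rw [hcomp, opD, coeff_single_same, hf.coeff_opPow_self, Real.rpow_one] at h1
  have hg1 : g.coeff 1 = ((leadReal f)⁻¹ : ℝ) := by
    rw [Complex.ofReal_inv]
    exact eq_inv_of_mul_eq_one_left h1.symm
  have hg1' : g.coeff 1 ≠ 0 := left_ne_zero_of_mul (h1 ▸ one_ne_zero)
  have hg0 : g ≠ 0 := fun h => hg1' (by rw [h, HahnSeries.coeff_zero])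
  have hord : g.order = 1 := by
    refine le_antisymm (order_le_of_coeff_ne_zero hg1') (not_lt.mp fun h => ?_)
    exact hg0 (coeff_order_eq_zero.mp (hlt _ h))
  refine ⟨g, ⟨hord, (leadReal f)⁻¹, inv_pos.mpr hf.leadReal_pos, ?_⟩, hcomp⟩
  rw [HahnSeries.leadingCoeff_eq, hord, hg1]

end IsStandardDelta

/-! ### Harmonic logarithms and the two graded sequences -/

theorem romanFactorial_ne_zero (a : ℝ) : romanFactorial a ≠ 0 := by
  rw [romanFactorial]
  split_ifs with h
  · exact div_ne_zero (pow_ne_zero _ (by norm_num)) (by exact_mod_cast Nat.factorial_ne_zero _)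
  · refine Real.Gamma_ne_zero fun m hm => h ?_
    exact ⟨m, by linarith⟩

theorem romanFactorial_zero : romanFactorial 0 = 1 := by
  rw [romanFactorial, if_neg, zero_add, Real.Gamma_one]
  rintro ⟨m, hm⟩
  have : (0 : ℝ) ≤ m := m.cast_nonneg
  linarith

theorem stirling_zero_ne_zero {a : ℝ} (h : ¬ ∃ m : ℕ, a = -((m : ℝ) + 1)) : stirling a 0 ≠ 0 := by
  have h1 : Complex.Gamma ((a : ℂ) + 1) ≠ 0 := by
    have : ((a : ℂ) + 1) = ((a + 1 : ℝ) : ℂ) := by push_cast; ring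
    rw [this, Complex.Gamma_ofReal, Complex.ofReal_ne_zero]
    refine Real.Gamma_ne_zero fun m hm => h ⟨m, by linarith⟩
  simpa [stirling] using h1

theorem stirling_neg_natCast_succ (m : ℕ) :
    stirling (-((m : ℝ) + 1)) 0 = 0 ∧ stirling (-((m : ℝ) + 1)) 1 ≠ 0 := by
  induction m with
  | zero =>
    have h : -(((0 : ℕ) : ℝ) + 1) = 0 - 1 := by simp
    rw [h, stirling_sub_one_zero, stirling_sub_one_succ]
    simp [stirling]
  | succ m ih =>
    have h : -(((m + 1 : ℕ) : ℝ) + 1) = -((m : ℝ) + 1) - 1 := by push_cast; ring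
    rw [h, stirling_sub_one_zero, stirling_sub_one_succ, ih.1]
    refine ⟨mul_zero _, ?_⟩
    rw [add_zero]
    refine mul_ne_zero ?_ ih.2
    have : (m : ℝ) + 1 ≠ 0 := by positivity
    exact_mod_cast neg_ne_zero.mpr this

/-- Only one power of `θ` contributes to the coefficient of `x ^ a * ℓ^β` in `λ_a^α(x)`. -/
theorem harmonicLog_apply_self (a : ℝ) {α β : ℕ →₀ ℝ} (k : ℕ) (h : β 0 + k = α 0) :
    harmonicLog a α a β =
      romanFactorial a * (stirling a k * ((theta ^ k) (Finsupp.single α 1)) β) := by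
  rw [harmonicLog, if_pos rfl, finsum_eq_single _ k]
  intro j hj
  rw [theta_pow_apply_eq_zero, mul_zero]
  intro h'
  apply hj
  have : (j : ℝ) = k := by linarith
  exact_mod_cast this

theorem theta_single_apply_sub_logProd (α : ℕ →₀ ℝ) (i : ℕ) :
    theta (Finsupp.single α 1) (α - logProd i) = α i := by
  rw [(theta_apply _ _).2, finsum_eq_single _ i]
  · simp [logProd_apply]
  · intro j hj
    rw [Finsupp.single_apply, if_neg, mul_zero]
    intro h
    apply hj
    apply logProd_injective
    have h1 : α + logProd i = α + logProd j := by
      nth_rewrite 1 [h]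
      abel
    exact (add_left_cancel h1).symm

/-- For `α ≠ 0` no harmonic logarithm vanishes: if `a` is not a negative integer, then `s(-a, 0) ≠ 0`;
otherwise `s(-a, 1) ≠ 0` and `θ ℓ^α ≠ 0`. -/
theorem exists_harmonicLog_ne_zero {α : ℕ →₀ ℝ} (hα : α ≠ 0) (a : ℝ) :
    ∃ β, harmonicLog a α a β ≠ 0 := by
  have hr : (romanFactorial a : ℂ) ≠ 0 := Complex.ofReal_ne_zero.mpr (romanFactorial_ne_zero a)
  by_cases h : ∃ m : ℕ, a = -((m : ℝ) + 1)
  · obtain ⟨i, hi⟩ := Finsupp.ne_iff.mp hα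
    refine ⟨α - logProd i, ?_⟩
    rw [harmonicLog_apply_self a 1 (by simp [logProd_apply]), pow_one,
      theta_single_apply_sub_logProd]
    obtain ⟨m, rfl⟩ := h
    exact mul_ne_zero hr (mul_ne_zero (stirling_neg_natCast_succ m).2 (by simpa using hi))
  · refine ⟨α, ?_⟩
    rw [harmonicLog_apply_self a 0 (by simp), pow_zero, Module.End.one_apply,
      Finsupp.single_eq_same, mul_one]
    exact mul_ne_zero hr (stirling_zero_ne_zero h)

section Coefficients

variable {α : ℕ →₀ ℝ}

theorem logCoeff_logSum (hα : α ≠ 0) (c : ℝ → ℂ) : logCoeff α (logSum α c) = c := by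
  funext b
  have h := exists_harmonicLog_ne_zero hα b
  rw [logCoeff, dif_pos h, logSum, mul_div_cancel_right₀ _ h.choose_spec]

theorem harmonicLog_eq_logSum (a : ℝ) (α : ℕ →₀ ℝ) :
    harmonicLog a α = logSum α (Pi.single a 1) := by
  funext b β
  by_cases h : b = a
  · subst h; simp [logSum]
  · simp [logSum, harmonicLog, h]

theorem smul_logSum (r : ℂ) (c : ℝ → ℂ) : r • logSum α c = logSum α fun b => r * c b := by
  funext b β
  simp [logSum, mul_assoc]

theorem augmentation_logSum (hα : α ≠ 0) (c : ℝ → ℂ) : augmentation α (logSum α c) = c 0 := by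
  rw [augmentation, logCoeff_logSum hα]

theorem skip_logSum (hα : α ≠ 0) (β : ℕ →₀ ℝ) (c : ℝ → ℂ) :
    skip β α (logSum α c) = logSum β c := by
  rw [skip, logCoeff_logSum hα]

theorem augmentation_opApply_logSum (hα : α ≠ 0) (f : ArtinianOp) (c : ℝ → ℂ) :
    augmentation α (opApply f α (logSum α c)) =
      ∑ᶠ b : ℝ, f.coeff b * (romanFactorial b : ℂ) * c b := by
  rw [opApply, augmentation_logSum hα, logCoeff_logSum hα]
  simp [romanFactorial_zero]

theorem augmentation_opApply_harmonicLog (hα : α ≠ 0) (f : ArtinianOp) (a : ℝ) :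
    augmentation α (opApply f α (harmonicLog a α)) = f.coeff a * (romanFactorial a : ℂ) := by
  rw [harmonicLog_eq_logSum, augmentation_opApply_logSum hα, finsum_eq_single _ a]
  · simp
  · intro b hb
    simp [hb]

end Coefficients

/-- The coefficient of `λ_b^α(x)` in the member of index `a` of the conjugate graded sequence. -/
def conjugateCoeff (f : ArtinianOp) (a b : ℝ) : ℂ :=
  (opPow f b).coeff a * (romanFactorial a : ℂ) / (romanFactorial b : ℂ)

/-- The conjugate graded sequence, by its coefficients. -/
def conjugateSeq (f : ArtinianOp) (a : ℝ) (α : ℕ →₀ ℝ) : LogSeries := logSum α (conjugateCoeff f a)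

theorem exists_exponent_ne_zero : ∃ α : ℕ →₀ ℝ, α ≠ 0 := exists_ne 0

theorem isRegular_conjugateSeq (f : ArtinianOp) : IsRegular (conjugateSeq f) := by
  intro a α β hα
  rw [conjugateSeq, conjugateSeq, skip_logSum hα]

/-- Regular families agree if they agree for a single `α ≠ 0`. -/
theorem IsRegular.eq_of_forall_eq {p q : ℝ → (ℕ →₀ ℝ) → LogSeries} (hp : IsRegular p)
    (hq : IsRegular q) {α : ℕ →₀ ℝ} (hα : α ≠ 0) (h : ∀ a, p a α = q a α) : p = q := by
  funext a β
  rw [hp a α β hα, hq a α β hα, h]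

theorem isStandardConjugate_iff (f : ArtinianOp) (p : ℝ → (ℕ →₀ ℝ) → LogSeries) :
    IsStandardConjugate f p ↔ p = conjugateSeq f := by
  have key : ∀ a α, α ≠ 0 → (logSum α fun b =>
      augmentation α (opApply (opPow f b) α (harmonicLog a α)) / (romanFactorial b : ℂ)) =
      conjugateSeq f a α := by
    intro a α hα
    simp only [augmentation_opApply_harmonicLog hα]
    rfl
  constructor
  · rintro ⟨hreg, hp⟩
    obtain ⟨α, hα⟩ := exists_exponent_ne_zero
    exact hreg.eq_of_forall_eq (isRegular_conjugateSeq f) hα fun a => by rw [hp a α hα, key a α hα]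
  · rintro rfl
    exact ⟨isRegular_conjugateSeq f, fun a α hα => (key a α hα).symm⟩

namespace IsStandardDelta

variable {f g : ArtinianOp}

/-- The matrix identity behind the theorem: the coefficients of
`(D ^ e * g^{b;0})(f;0) = f^{e;0} * D ^ b`, where `g(f;0) = D`. -/
theorem finsum_coeff_opPow_mul (hf : IsStandardDelta f) (hg : IsStandardDelta g)
    (h : hf.comp g = opD) (a b e : ℝ) :
    ∑ᶠ x : ℝ, (opPow g b).coeff x * (opPow f (e + x)).coeff a = (opPow f e).coeff (a - b) := by
  have h1 := congrArg (fun k : ArtinianOp => k.coeff a) (hf.comp_mul (single e 1) (opPow g b))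
  simp only [hf.comp_single, hf.comp_opPow hg h, hf.coeff_comp, coeff_mul_single, mul_one] at h1
  rw [← h1, ← finsum_comp_equiv (Equiv.addLeft e)
    (f := fun y => (single e (1 : ℂ) * opPow g b).coeff y * (opPow f y).coeff a)]
  refine finsum_congr fun x => ?_
  simp [coeff_single_mul]

theorem wellFoundedOn_support_conjugateCoeff (hf : IsStandardDelta f) (a : ℝ) :
    (Function.support (conjugateCoeff f a)).WellFoundedOn (· > ·) := by
  have h1 : (defectMonoid f : Set ℝ).WellFoundedOn (· < ·) := hf.isPWO_defectMonoid.isWF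
  have h2 : (fun b => a - b) '' Function.support (conjugateCoeff f a) ⊆ defectMonoid f := by
    rintro _ ⟨b, hb, rfl⟩
    refine hf.sub_mem_of_coeff_opPow_ne_zero fun h0 => hb ?_
    simp [conjugateCoeff, h0]
  have h3 := Set.wellFoundedOn_image.mp (h1.subset h2)
  refine h3.mono (fun b b' hb => ?_) subset_rfl
  change a - b < a - b'
  exact sub_lt_sub_left hb a

/-- If `g(f;0) = D`, then the conjugate graded sequence of `f` is the associated one of `g`. -/
theorem isStandardAssociated_conjugateSeq (hf : IsStandardDelta f) (hg : IsStandardDelta g)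
    (h : hf.comp g = opD) : IsStandardAssociated g (conjugateSeq f) := by
  have hr : ∀ a, (romanFactorial a : ℂ) ≠ 0 := fun a =>
    Complex.ofReal_ne_zero.mpr (romanFactorial_ne_zero a)
  have haug : ∀ a α, α ≠ 0 → augmentation α (conjugateSeq f a α) =
      (1 : ArtinianOp).coeff a * romanFactorial a := by
    intro a α hα
    rw [conjugateSeq, augmentation_logSum hα, conjugateCoeff, hf.opPow_zero, romanFactorial_zero]
    simp
  refine ⟨⟨isRegular_conjugateSeq f, fun a α hα => ⟨⟨_, hf.wellFoundedOn_support_conjugateCoeff a,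
    rfl⟩, ?_, fun b hb => ?_⟩⟩, fun α hα => ⟨?_, fun a ha => ?_, fun a b => ?_⟩⟩
  · rw [conjugateSeq, logCoeff_logSum hα]
    exact div_ne_zero (mul_ne_zero (hf.coeff_opPow_self_ne_zero a) (hr a)) (hr a)
  · rw [conjugateSeq, logCoeff_logSum hα, conjugateCoeff, hf.coeff_opPow_of_lt hb, zero_mul,
      zero_div]
  · rw [haug 0 α hα, romanFactorial_zero]
    simp
  · rw [haug a α hα, HahnSeries.coeff_one, if_neg ha, zero_mul]
  · rw [opApply, conjugateSeq, conjugateSeq, smul_logSum, logCoeff_logSum hα]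
    congr 1
    funext e
    have hterm : ∀ x : ℝ, (opPow g b).coeff x *
        ((romanFactorial (e + x) / romanFactorial e : ℝ) : ℂ) * conjugateCoeff f a (e + x) =
        (romanFactorial a : ℂ) / romanFactorial e *
          ((opPow g b).coeff x * (opPow f (e + x)).coeff a) := by
      intro x
      have h1 := hr (e + x)
      have h2 := hr e
      rw [conjugateCoeff]
      push_cast
      field_simp
    simp only [hterm]
    rw [← mul_finsum, hf.finsum_coeff_opPow_mul hg h, conjugateCoeff]
    have h1 := hr (a - b)
    have h2 := hr e
    push_cast
    field_simp

/-- An upper triangular matrix with nonzero diagonal, such as that of the coefficients of the powers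
`f^{b;0}`, is injective on coefficient families with Noetherian support. -/
theorem eq_of_forall_finsum_eq (hf : IsStandardDelta f) {c d : ℝ → ℂ}
    (hc : (Function.support c).WellFoundedOn (· > ·))
    (hd : (Function.support d).WellFoundedOn (· > ·))
    (h : ∀ b : ℝ, ∑ᶠ x, (opPow f b).coeff x * c x = ∑ᶠ x, (opPow f b).coeff x * d x) : c = d := by
  have hfin : ∀ {c : ℝ → ℂ}, (Function.support c).WellFoundedOn (· > ·) → ∀ b,
      (Function.support fun x => (opPow f b).coeff x * c x).Finite := by
    intro c hc b
    -- Negation turns a Noetherian support into a well-ordered one.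
    have hT : (Neg.neg '' Function.support c).IsPWO := by
      refine Set.IsWF.isPWO (Set.wellFoundedOn_image.mpr (hc.mono (fun x y hxy => ?_) subset_rfl))
      exact neg_lt_neg_iff.mp hxy
    refine ((finite_setOf_mem_and_sub_mem hf.isPWO_defectMonoid hT (-b)).preimage
      (f := fun x => x - b) (sub_left_injective.injOn)).subset fun x hx => ?_
    exact ⟨hf.sub_mem_of_coeff_opPow_ne_zero (left_ne_zero_of_mul hx), x, right_ne_zero_of_mul hx,
      by ring⟩
  by_contra hne
  have hu : (Function.support fun x => c x - d x).WellFoundedOn (· > ·) := by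
    refine (hc.union hd).subset fun x hx => ?_
    by_contra hx'
    simp only [Set.mem_union, Function.mem_support, not_or, not_not] at hx'
    exact hx (by simp [hx'])
  obtain ⟨x₀, hx₀⟩ : (Function.support fun x => c x - d x).Nonempty := by
    obtain ⟨x, hx⟩ := Function.ne_iff.mp hne
    exact ⟨x, sub_ne_zero.mpr hx⟩
  obtain ⟨⟨m, hm⟩, -, hmin⟩ := hu.has_min Set.univ ⟨⟨x₀, hx₀⟩, trivial⟩
  -- At the largest exponent `m` where `c` and `d` differ, the row `m` has a single term.
  have h1 : ∑ᶠ x, (opPow f m).coeff x * (c x - d x) = 0 := by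
    simp only [mul_sub]
    rw [finsum_sub_distrib (hfin hc m) (hfin hd m), h, sub_self]
  rw [finsum_eq_single _ m] at h1
  · exact mul_ne_zero (hf.coeff_opPow_self_ne_zero m) hm h1
  · intro x hx
    rcases hx.lt_or_gt with hlt | hgt
    · rw [hf.coeff_opPow_of_lt hlt, zero_mul]
    · by_contra h0
      exact hmin ⟨x, right_ne_zero_of_mul h0⟩ trivial hgt

theorem eq_of_isStandardAssociated (hf : IsStandardDelta f) {p q : ℝ → (ℕ →₀ ℝ) → LogSeries}
    (hp : IsStandardAssociated f p) (hq : IsStandardAssociated f q) : p = q := by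
  obtain ⟨α, hα⟩ := exists_exponent_ne_zero
  refine hp.1.1.eq_of_forall_eq hq.1.1 hα fun a => ?_
  have key : ∀ {p : ℝ → (ℕ →₀ ℝ) → LogSeries}, IsStandardAssociated f p → ∃ c : ℝ → ℂ,
      p a α = logSum α c ∧
      (Function.support fun x => (romanFactorial x : ℂ) * c x).WellFoundedOn (· > ·) ∧
      ∀ b : ℝ, ∑ᶠ x, (opPow f b).coeff x * ((romanFactorial x : ℂ) * c x) =
        if a = b then (romanFactorial a : ℂ) else 0 := by
    intro p hp
    obtain ⟨c, hc, hpc⟩ := (hp.1.2 a α hα).1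
    refine ⟨c, hpc, hc.subset fun x hx => right_ne_zero_of_mul hx, fun b => ?_⟩
    obtain ⟨h0, h1, h2⟩ := hp.2 α hα
    obtain ⟨c', -, hpc'⟩ := (hp.1.2 (a - b) α hα).1
    have h3 := congrArg (augmentation α) (h2 a b)
    rw [hpc, augmentation_opApply_logSum hα, hpc', smul_logSum, augmentation_logSum hα,
      ← augmentation_logSum hα c', ← hpc'] at h3
    simp only [← mul_assoc]
    rw [h3]
    split_ifs with hab
    · subst hab
      rw [sub_self, h0, romanFactorial_zero, mul_one, div_one]
    · rw [h1 _ (sub_ne_zero.mpr hab), mul_zero]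
  obtain ⟨c, hpc, hc, hc'⟩ := key hp
  obtain ⟨d, hqd, hd, hd'⟩ := key hq
  have h := hf.eq_of_forall_finsum_eq hc hd fun b => by rw [hc', hd']
  rw [hpc, hqd]
  congr 1
  funext x
  exact mul_left_cancel₀ (Complex.ofReal_ne_zero.mpr (romanFactorial_ne_zero x)) (congrFun h x)

theorem isStandardAssociated_iff (hf : IsStandardDelta f) (hg : IsStandardDelta g)
    (h : hf.comp g = opD) (p : ℝ → (ℕ →₀ ℝ) → LogSeries) :
    IsStandardAssociated g p ↔ p = conjugateSeq f := by
  have hs := hf.isStandardAssociated_conjugateSeq hg h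
  exact ⟨fun hp => hg.eq_of_isStandardAssociated hp hs, by rintro rfl; exact hs⟩

end IsStandardDelta

end LogAlg

end

theorem mainTheorem1 (f : LogAlg.ArtinianOp) (hf : LogAlg.IsStandardDelta f) :
    (∃! g : LogAlg.ArtinianOp, LogAlg.IsStandardDelta g ∧ LogAlg.IsCompInverse f g) ∧
    ∀ g : LogAlg.ArtinianOp, LogAlg.IsStandardDelta g → LogAlg.IsCompInverse f g →
      (∃! p : ℝ → (ℕ →₀ ℝ) → LogAlg.LogSeries, LogAlg.IsStandardAssociated f p) ∧
      (∃! p : ℝ → (ℕ →₀ ℝ) → LogAlg.LogSeries, LogAlg.IsStandardConjugate f p) ∧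
      (∀ p : ℝ → (ℕ →₀ ℝ) → LogAlg.LogSeries,
        LogAlg.IsStandardAssociated f p ↔ LogAlg.IsStandardConjugate g p) ∧
      ∀ p : ℝ → (ℕ →₀ ℝ) → LogAlg.LogSeries,
        LogAlg.IsStandardConjugate f p ↔ LogAlg.IsStandardAssociated g p := by
  refine ⟨?_, fun g hg hfg => ?_⟩
  · obtain ⟨g, hg, h⟩ := hf.exists_comp_eq_opD
    refine ⟨g, ⟨hg, hg.isComp_iff.mpr (hf.comp_eq_opD_symm hg h), hf.isComp_iff.mpr h⟩, ?_⟩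
    rintro g' ⟨-, -, hg'⟩
    exact hf.comp_injective ((hf.isComp_iff.mp hg').trans h.symm)
  · have h1 := hg.isComp_iff.mp hfg.1
    have h2 := hf.isComp_iff.mp hfg.2
    simp only [hg.isStandardAssociated_iff hf h1, hf.isStandardAssociated_iff hg h2,
      LogAlg.isStandardConjugate_iff]
    exact ⟨⟨_, rfl, fun _ h => h⟩, ⟨_, rfl, fun _ h => h⟩, fun _ => trivial, fun _ => trivial⟩
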